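/- Notation: for a bit string $x\in\{0,1\}^n$ let $\hat x\in\{\pm1\}^n$, $\hat x_k=(-1)^{x_k}$. A matchgate is a two-qubit operation which, in the standard basis, acts as a matrix $A\in SU(2)$ on the span of $|00\rangle,|11\rangle$ and as a matrix $B\in SU(2)$ on the span of $|01\rangle,|10\rangle$. An $m$-qubit matchgate circuit is a finite product of matchgates acting on nearest-neighbour qubits $k,k+1$ of a line of $m$ qubits. An $m$-qubit circuit $U$ with $m\ge n$ computes $f:\{0,1\}^n\to\{0,1\}$ with probability at least $p$ if, for every $x\in\{0,1\}^n$, measuring the first qubit of $U|x,0\rangle$ ($0$ denoting $m-n$ zeroes) in the computational basis yields $f(x)$ with probability at least $p$. A family $\{f_n: n=1,2,\dots\}$ of boolean functions, $f_n:\{0,1\}^n\to\{0,1\}$, is matchgate-computable with poly-bounded error if there are probabilities $p_n\in(\frac12,1]$ and a polynomial $q$ such that $q(n)>0$ and $p_n\ge\frac12+\frac1{q(n)}$ for all sufficiently large $n$, and such that for every $n\ge1$ some matchgate circuit on some number $m\ge n$ of qubits (no bound on $m$ or on the number of gates is imposed) computes $f_n$ with probability at least $p_n$. A function $f:\{0,1\}^n\to\{0,1\}$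 is a linear threshold gate if it has a representation, i.e. a pair $(w,\theta)\in\mathbb R^n\times\mathbb R$ with $(-1)^{f(x)}=\mathrm{sign}(w^T\hat x+\theta)$ for all $x$ (where $\mathrm{sign}(0)=0$); its integer weight is the minimum of $\sum_k|w_k|+|\theta|$ over its representations with integer entries. The family $\{f_n\}$ is a family of linear threshold gates with polynomial integer weight if every $f_n$ is a linear threshold gate and, for some polynomial $r$, the integer weight of $f_n$ is at most $r(n)$ for every $n\ge1$. Theorem. A family $\{f_n: n=1,2,\dots\}$ of boolean functions, where $f_n$ acts on $n$ bits, is matchgate-computable with poly-bounded error if and only if it is a family of linear threshold gates with polynomial integer weight. -/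

import Mathlib

open scoped BigOperators Polynomial

noncomputable section

namespace Matchgates

/-- Bit strings of length `n`. -/
abbrev BitString (n : ℕ) : Type := Fin n → Fin 2

/-- The sign `(-1)^b` of a bit: `0 ↦ 1`, `1 ↦ -1`. -/
def bitSign (b : Fin 2) : ℝ := (-1) ^ (b : ℕ)

/-! ### Matchgate circuits -/

/-- The two-qubit operation acting as `A` on the span of `|00⟩, |11⟩` and as `B` on the span of
`|01⟩, |10⟩` (in these orders). A two-qubit basis state `|s t⟩` is the pair `(s, t)`; in each of the
two blocks it is labelled by its first bit `s`. -/
def gate (A B : Matrix (Fin 2) (Fin 2) ℂ) : Matrix (Fin 2 × Fin 2) (Fin 2 × Fin 2) ℂ :=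
  Matrix.of fun s t =>
    if s.1 = s.2 ∧ t.1 = t.2 then A s.1 t.1
    else if s.1 ≠ s.2 ∧ t.1 ≠ t.2 then B s.1 t.1
    else 0

/-- A matchgate: both blocks belong to `SU(2)`. -/
def IsMatchgate (G : Matrix (Fin 2 × Fin 2) (Fin 2 × Fin 2) ℂ) : Prop :=
  ∃ A ∈ Matrix.specialUnitaryGroup (Fin 2) ℂ, ∃ B ∈ Matrix.specialUnitaryGroup (Fin 2) ℂ,
    G = gate A B

/-- The operator on `m` qubits that applies `G` to the neighbouring qubits `k` and `k + 1`
and the identity to all other qubits. -/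
def onNeighbours (m k : ℕ) (hk : k + 1 < m) (G : Matrix (Fin 2 × Fin 2) (Fin 2 × Fin 2) ℂ) :
    Matrix (BitString m) (BitString m) ℂ :=
  Matrix.of fun z y =>
    if ∀ j : Fin m, (j : ℕ) ≠ k → (j : ℕ) ≠ k + 1 → z j = y j then
      G (z ⟨k, Nat.lt_of_succ_lt hk⟩, z ⟨k + 1, hk⟩) (y ⟨k, Nat.lt_of_succ_lt hk⟩, y ⟨k + 1, hk⟩)
    else 0

/-- A matchgate circuit on `m` qubits: a finite product of nearest-neighbour matchgates. -/
def IsMatchgateCircuit (m : ℕ) (U : Matrix (BitString m) (BitString m) ℂ) : Prop :=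
  U ∈ Submonoid.closure
    {V | ∃ (k : ℕ) (hk : k + 1 < m) (G : Matrix (Fin 2 × Fin 2) (Fin 2 × Fin 2) ℂ),
      IsMatchgate G ∧ V = onNeighbours m k hk G}

/-- The string `x, 0` of length `m`: the string `x` followed by zeroes. -/
def pad {n : ℕ} (m : ℕ) (x : BitString n) : BitString m :=
  fun j => if h : (j : ℕ) < n then x ⟨j, h⟩ else 0

/-- The computational basis state `|y⟩`. -/
def ket {m : ℕ} (y : BitString m) : BitString m → ℂ := Pi.single y 1

/-- The probability that a computational basis measurement of the first qubit of the state `ψ`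
yields the outcome `b`. -/
def probFirst {m : ℕ} (hm : 0 < m) (ψ : BitString m → ℂ) (b : Fin 2) : ℝ :=
  ∑ z : BitString m, if z ⟨0, hm⟩ = b then ‖ψ z‖ ^ 2 else 0

/-- `U` computes `f` with probability at least `p`. -/
def Computes {n m : ℕ} (hm : 0 < m) (U : Matrix (BitString m) (BitString m) ℂ)
    (f : BitString n → Fin 2) (p : ℝ) : Prop :=
  ∀ x : BitString n, p ≤ probFirst hm (U.mulVec (ket (pad m x))) (f x)

/-- `f` is matchgate-computable with probability at least `p`. -/
def MatchgateComputable {n : ℕ} (f : BitString n → Fin 2) (p : ℝ) : Prop :=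
  ∃ (m : ℕ) (hm : 0 < m) (U : Matrix (BitString m) (BitString m) ℂ),
    n ≤ m ∧ IsMatchgateCircuit m U ∧ Computes hm U f p

/-- The family `f 1, f 2, …` is matchgate-computable with poly-bounded error: there are
probabilities `p n > 1/2`, for large `n` bounded away from `1/2` by the inverse of a polynomial,
such that every `f n` is matchgate-computable with probability at least `p n`. -/
def MatchgateComputablePolyBounded (f : (n : ℕ) → BitString n → Fin 2) : Prop :=
  ∃ p : ℕ → ℝ,
    (∀ n, 1 ≤ n → 1 / 2 < p n ∧ p n ≤ 1) ∧
    (∃ (q : ℕ[X]) (N : ℕ), ∀ n, N ≤ n →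
      0 < q.eval n ∧ 1 / 2 + 1 / ((q.eval n : ℕ) : ℝ) ≤ p n) ∧
    ∀ n, 1 ≤ n → MatchgateComputable (f n) (p n)

/-! ### Linear threshold gates -/

/-- `(w, θ)` is a representation of `f`: for every `x`, the sign of `∑ k, w k * (-1)^(x k) + θ`
is `(-1)^(f x)`; in particular that number is not zero. -/
def IsRepresentation {n : ℕ} (w : Fin n → ℝ) (θ : ℝ) (f : BitString n → Fin 2) : Prop :=
  ∀ x : BitString n, Real.sign (∑ k, w k * bitSign (x k) + θ) = bitSign (f x)

/-- `f` is a linear threshold gate. -/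
def IsLTG {n : ℕ} (f : BitString n → Fin 2) : Prop :=
  ∃ (w : Fin n → ℝ) (θ : ℝ), IsRepresentation w θ f

/-- The integer weight of `f`: the minimal 1-norm of a representation with integer entries
(`⊤` if there is none). -/
def integerWeight {n : ℕ} (f : BitString n → Fin 2) : ℕ∞ :=
  ⨅ (v : Fin n → ℤ) (φ : ℤ) (_ : IsRepresentation (fun k => (v k : ℝ)) (φ : ℝ) f),
    ((∑ k, (v k).natAbs + φ.natAbs : ℕ) : ℕ∞)

/-- The family `f 1, f 2, …` is a family of linear threshold gates with polynomial integer
weight. -/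
def IsLTGFamilyPolyIntegerWeight (f : (n : ℕ) → BitString n → Fin 2) : Prop :=
  (∀ n, 1 ≤ n → IsLTG (f n)) ∧
    ∃ q : ℕ[X], ∀ n, 1 ≤ n → integerWeight (f n) ≤ ((q.eval n : ℕ) : ℕ∞)

end Matchgates

end

open scoped Kronecker

namespace Matchgates

/-! Conjugation by a matchgate circuit `U` maps every Majorana operator into the span of the
Majorana operators. The observable measured, `Z` on the first qubit, is `-i` times the product of
that qubit's two Majorana operators, so its conjugate `U† Z U` is quadratic in them. On the diagonal
of a quadratic expression only pairs on the same qubit survive, and they contribute constants or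
multiples of signs `(-1)^(y k)`. The expected value of `Z` is therefore affine in the signs of the
input bits; it lies in `[-1, 1]`, and success probability `p` becomes margin `2p - 1`
(`MatchgateComputable.exists_affine`).

Conversely, every affine function of 1-norm one is such an expectation
(`MatchgateComputable.of_affine`). A chain of matchgates spreads the first `X`-Majorana with
amplitudes `√|v j|` and the first `Y`-Majorana with amplitudes `sign (v j) √|v j|`; the products of
the amplitudes are the coefficients `v j`.

The rest is a comparison of margin and weight. Values in `[-1, 1]` force 1-norm at most one, so a
function with margin `δ`, scaled by about `(n + 1) / δ`, can be rounded to an integer representation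
of that order of weight. An integer representation has margin at least one before normalisation,
hence at least the inverse of its weight afterwards. -/

/-- The tensor product of the single-qubit operators `σ 0, …, σ (m - 1)`. -/
def tensorMatrix (m : ℕ) (σ : ℕ → Matrix (Fin 2) (Fin 2) ℂ) :
    Matrix (BitString m) (BitString m) ℂ :=
  Matrix.of fun z y => ∏ j : Fin m, σ j (z j) (y j)

lemma tensorMatrix_mul (m : ℕ) (σ τ : ℕ → Matrix (Fin 2) (Fin 2) ℂ) :
    tensorMatrix m σ * tensorMatrix m τ = tensorMatrix m (fun j => σ j * τ j) := by
  ext z y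
  simp only [tensorMatrix, Matrix.mul_apply, Matrix.of_apply, Finset.prod_univ_sum,
    Fintype.piFinset_univ, Finset.prod_mul_distrib]

lemma tensorMatrix_one (m : ℕ) : tensorMatrix m (fun _ => 1) = 1 := by
  ext z y
  simp only [tensorMatrix, Matrix.of_apply, Matrix.one_apply]
  split_ifs with h
  · simp [h]
  · obtain ⟨j, hj⟩ := Function.ne_iff.1 h
    exact Finset.prod_eq_zero (Finset.mem_univ j) (if_neg hj)

/-! ### Embedding two-qubit operators into the line -/

section Neighbours

variable {m k : ℕ} (hk : k + 1 < m)

lemma onNeighbours_add (M N : Matrix (Fin 2 × Fin 2) (Fin 2 × Fin 2) ℂ) :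
    onNeighbours m k hk (M + N) = onNeighbours m k hk M + onNeighbours m k hk N := by
  ext z y
  simp only [onNeighbours, Matrix.of_apply, Matrix.add_apply]
  split_ifs <;> simp

lemma onNeighbours_smul (c : ℂ) (M : Matrix (Fin 2 × Fin 2) (Fin 2 × Fin 2) ℂ) :
    onNeighbours m k hk (c • M) = c • onNeighbours m k hk M := by
  ext z y
  simp only [onNeighbours, Matrix.of_apply, Matrix.smul_apply]
  split_ifs <;> simp

lemma onNeighbours_zero : onNeighbours m k hk 0 = 0 := by
  ext z y
  simp [onNeighbours]

lemma onNeighbours_conjTranspose (M : Matrix (Fin 2 × Fin 2) (Fin 2 × Fin 2) ℂ) :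
    onNeighbours m k hk M.conjTranspose = (onNeighbours m k hk M).conjTranspose := by
  ext z y
  have : (∀ j : Fin m, (j : ℕ) ≠ k → (j : ℕ) ≠ k + 1 → z j = y j) ↔
      (∀ j : Fin m, (j : ℕ) ≠ k → (j : ℕ) ≠ k + 1 → y j = z j) :=
    ⟨fun h j h1 h2 => (h j h1 h2).symm, fun h j h1 h2 => (h j h1 h2).symm⟩
  simp only [onNeighbours, Matrix.of_apply, Matrix.conjTranspose_apply, this]
  split_ifs <;> simp

lemma onNeighbours_kronecker (A B : Matrix (Fin 2) (Fin 2) ℂ) :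
    onNeighbours m k hk (A ⊗ₖ B) =
      tensorMatrix m (fun j => if j = k then A else if j = k + 1 then B else 1) := by
  ext z y
  simp only [onNeighbours, tensorMatrix, Matrix.of_apply, Matrix.kroneckerMap_apply]
  split_ifs with h
  · rw [Finset.prod_eq_mul (⟨k, Nat.lt_of_succ_lt hk⟩ : Fin m) ⟨k + 1, hk⟩]
    · simp
    · simp [Fin.ext_iff]
    · rintro j - ⟨h1, h2⟩
      rw [Ne, Fin.ext_iff] at h1 h2
      rw [if_neg h1, if_neg h2, h j h1 h2, Matrix.one_apply_eq]
    · simp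
    · simp
  · push Not at h
    obtain ⟨j, h1, h2, h3⟩ := h
    refine (Finset.prod_eq_zero (Finset.mem_univ j) ?_).symm
    rw [if_neg h1, if_neg h2, Matrix.one_apply_ne h3]

/-- Matrix units are Kronecker products. Identities linear in a two-qubit operator thus reduce to
product operators, which embed as tensor products and are compared qubit by qubit. -/
lemma kronecker_induction {p : Matrix (Fin 2 × Fin 2) (Fin 2 × Fin 2) ℂ → Prop}
    (M : Matrix (Fin 2 × Fin 2) (Fin 2 × Fin 2) ℂ) (zero : p 0)
    (add : ∀ M N, p M → p N → p (M + N)) (kronecker : ∀ A B, p (A ⊗ₖ B)) : p M := by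
  refine Matrix.induction_on' M zero add fun i j x => ?_
  have : Matrix.single i j x = Matrix.single i.1 j.1 x ⊗ₖ Matrix.single i.2 j.2 (1 : ℂ) := by
    simp [Matrix.single_kronecker_single]
  rw [this]
  exact kronecker _ _

lemma onNeighbours_mul (M N : Matrix (Fin 2 × Fin 2) (Fin 2 × Fin 2) ℂ) :
    onNeighbours m k hk (M * N) = onNeighbours m k hk M * onNeighbours m k hk N := by
  induction M using kronecker_induction with
  | zero => simp [onNeighbours_zero]
  | add M M' h h' => simp [add_mul, onNeighbours_add, h, h']
  | kronecker A B =>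
    induction N using kronecker_induction with
    | zero => simp [onNeighbours_zero]
    | add M M' h h' => simp [mul_add, onNeighbours_add, h, h']
    | kronecker C D =>
      rw [← Matrix.mul_kronecker_mul]
      simp only [onNeighbours_kronecker, tensorMatrix_mul]
      congr 1
      funext j
      split_ifs <;> simp

lemma onNeighbours_one : onNeighbours m k hk 1 = 1 := by
  rw [← Matrix.one_kronecker_one, onNeighbours_kronecker, ← tensorMatrix_one]
  simp

/-- An operator acting trivially on two neighbouring qubits commutes with every operator on these
qubits. -/
lemma commute_tensorMatrix_onNeighbours {σ : ℕ → Matrix (Fin 2) (Fin 2) ℂ} (h0 : σ k = 1)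
    (h1 : σ (k + 1) = 1) (M : Matrix (Fin 2 × Fin 2) (Fin 2 × Fin 2) ℂ) :
    Commute (tensorMatrix m σ) (onNeighbours m k hk M) := by
  induction M using kronecker_induction with
  | zero => simp [onNeighbours_zero]
  | add M M' h h' => simpa [onNeighbours_add] using h.add_right h'
  | kronecker A B =>
    rw [onNeighbours_kronecker, Commute, SemiconjBy, tensorMatrix_mul, tensorMatrix_mul]
    congr 1
    funext j
    split_ifs <;> simp [*]

end Neighbours

/-! ### Majorana operators -/

/-- The Pauli matrix `X`. -/
def pauliX : Matrix (Fin 2) (Fin 2) ℂ := !![0, 1; 1, 0]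

/-- The Pauli matrix `Y`. -/
def pauliY : Matrix (Fin 2) (Fin 2) ℂ := !![0, -Complex.I; Complex.I, 0]

/-- The Pauli matrix `Z`. -/
def pauliZ : Matrix (Fin 2) (Fin 2) ℂ := !![1, 0; 0, -1]

lemma pauliZ_mul_self : pauliZ * pauliZ = 1 := by
  ext i j; fin_cases i <;> fin_cases j <;> simp [pauliZ]

/-- The Jordan-Wigner operator acting as `Z` on the qubits before `j` and as `σ` on qubit `j`;
for `σ = X` and `σ = Y` these are the Majorana operators. -/
def jordanWigner (m : ℕ) (σ : Matrix (Fin 2) (Fin 2) ℂ) (j : ℕ) :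
    Matrix (BitString m) (BitString m) ℂ :=
  tensorMatrix m fun i => if i < j then pauliZ else if i = j then σ else 1

section

variable {m k : ℕ} (hk : k + 1 < m) (σ : Matrix (Fin 2) (Fin 2) ℂ)

/-- The Jordan-Wigner string: `Z` on all qubits before `k`. -/
def zString (m k : ℕ) : Matrix (BitString m) (BitString m) ℂ :=
  tensorMatrix m fun i => if i < k then pauliZ else 1

lemma zString_commute (M : Matrix (Fin 2 × Fin 2) (Fin 2 × Fin 2) ℂ) :
    Commute (zString m k) (onNeighbours m k hk M) :=
  commute_tensorMatrix_onNeighbours hk (by simp) (by simp) M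

/-- Together with `jordanWigner_second` this splits off a common string on the qubits before `k`,
which commutes with a gate on `k, k + 1`; what remains is a computation with 4 × 4 matrices. -/
lemma jordanWigner_first :
    jordanWigner m σ k = zString m k * onNeighbours m k hk (σ ⊗ₖ 1) := by
  rw [onNeighbours_kronecker, zString, tensorMatrix_mul, jordanWigner]
  congr 1
  funext i
  rcases lt_trichotomy i k with h | rfl | h
  · simp [h, h.ne, (h.trans (Nat.lt_succ_self k)).ne]
  · simp
  · simp [h.not_gt, h.ne']

lemma jordanWigner_second :
    jordanWigner m σ (k + 1) = zString m k * onNeighbours m k hk (pauliZ ⊗ₖ σ) := by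
  rw [onNeighbours_kronecker, zString, tensorMatrix_mul, jordanWigner]
  congr 1
  funext i
  rcases lt_trichotomy i k with h | rfl | h
  · simp [h, h.ne, h.trans (Nat.lt_succ_self k), (h.trans (Nat.lt_succ_self k)).ne]
  · simp
  · simp [h.not_gt, h.ne', show ¬ i < k + 1 by omega]

/-- Jordan-Wigner operators on other qubits commute with the even operators on the qubits
`k` and `k + 1`. -/
lemma jordanWigner_commute {j : ℕ} (h0 : j ≠ k) (h1 : j ≠ k + 1)
    {M : Matrix (Fin 2 × Fin 2) (Fin 2 × Fin 2) ℂ} (hM : Commute (pauliZ ⊗ₖ pauliZ) M) :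
    Commute (jordanWigner m σ j) (onNeighbours m k hk M) := by
  rcases lt_or_gt_of_ne h0 with h | h
  · exact commute_tensorMatrix_onNeighbours hk (by simp [h.not_gt, h.ne'])
      (by simp [show ¬ k + 1 < j by omega, h1.symm]) M
  · have h2 : k + 1 < j := by omega
    -- The string of a later qubit crosses both gate qubits, so it restricts to `Z ⊗ Z` there, which
    -- commutes with parity-preserving gates.
    have : jordanWigner m σ j = tensorMatrix m (fun i => if i = k then 1 else if i = k + 1 then 1
        else if i < j then pauliZ else if i = j then σ else 1) *
          onNeighbours m k hk (pauliZ ⊗ₖ pauliZ) := by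
      rw [onNeighbours_kronecker, tensorMatrix_mul, jordanWigner]
      congr 1
      funext i
      by_cases hi : i = k
      · simp [hi, h]
      · by_cases hi' : i = k + 1
        · simp [hi', h2]
        · simp [hi, hi']
    rw [this]
    refine Commute.mul_left (commute_tensorMatrix_onNeighbours hk (by simp) (by simp) M) ?_
    rw [Commute, SemiconjBy, ← onNeighbours_mul, hM.eq, onNeighbours_mul]

end

/-! ### Matchgates act linearly on Majorana operators -/

lemma gate_conjTranspose (A B : Matrix (Fin 2) (Fin 2) ℂ) :
    (gate A B).conjTranspose = gate A.conjTranspose B.conjTranspose := by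
  ext ⟨s1, s2⟩ ⟨t1, t2⟩
  fin_cases s1 <;> fin_cases s2 <;> fin_cases t1 <;> fin_cases t2 <;>
    simp [gate, Matrix.conjTranspose_apply]

lemma gate_mul (A B A' B' : Matrix (Fin 2) (Fin 2) ℂ) :
    gate A B * gate A' B' = gate (A * A') (B * B') := by
  ext ⟨s1, s2⟩ ⟨t1, t2⟩
  fin_cases s1 <;> fin_cases s2 <;> fin_cases t1 <;> fin_cases t2 <;>
    simp [gate, Matrix.mul_apply, Fintype.sum_prod_type]

lemma gate_one : gate 1 1 = 1 := by
  ext ⟨s1, s2⟩ ⟨t1, t2⟩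
  fin_cases s1 <;> fin_cases s2 <;> fin_cases t1 <;> fin_cases t2 <;> simp [gate]

lemma gate_commute (A B : Matrix (Fin 2) (Fin 2) ℂ) :
    Commute (pauliZ ⊗ₖ pauliZ) (gate A B) := by
  ext ⟨s1, s2⟩ ⟨t1, t2⟩
  fin_cases s1 <;> fin_cases s2 <;> fin_cases t1 <;> fin_cases t2 <;>
    simp [gate, pauliZ, Matrix.mul_apply, Fintype.sum_prod_type]

lemma IsMatchgate.conjTranspose_mul_self {G : Matrix (Fin 2 × Fin 2) (Fin 2 × Fin 2) ℂ}
    (hG : IsMatchgate G) : G.conjTranspose * G = 1 := by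
  obtain ⟨A, hA, B, hB, rfl⟩ := hG
  have h1 := Matrix.mem_unitaryGroup_iff'.1 (Matrix.mem_specialUnitaryGroup_iff.1 hA).1
  have h2 := Matrix.mem_unitaryGroup_iff'.1 (Matrix.mem_specialUnitaryGroup_iff.1 hB).1
  rw [Matrix.star_eq_conjTranspose] at h1 h2
  rw [gate_conjTranspose, gate_mul, h1, h2, gate_one]

/-- Determinant one makes the adjugate the inverse. This is how the determinant condition on the
blocks enters. -/
lemma conjTranspose_eq_adjugate {A : Matrix (Fin 2) (Fin 2) ℂ}
    (hA : A ∈ Matrix.specialUnitaryGroup (Fin 2) ℂ) : A.conjTranspose = A.adjugate := by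
  obtain ⟨h1, h2⟩ := Matrix.mem_specialUnitaryGroup_iff.1 hA
  have h3 := Matrix.mem_unitaryGroup_iff'.1 h1
  rw [Matrix.star_eq_conjTranspose] at h3
  calc A.conjTranspose = A.conjTranspose * (A * A.adjugate) := by
        rw [Matrix.mul_adjugate, h2, one_smul, mul_one]
    _ = A.adjugate := by rw [← mul_assoc, h3, one_mul]

/-- The general complex combination of the four Majorana operators of two qubits. -/
def majoranaPair (p q r u : ℂ) : Matrix (Fin 2 × Fin 2) (Fin 2 × Fin 2) ℂ :=
  p • (pauliX ⊗ₖ 1) + q • (pauliY ⊗ₖ 1) + r • (pauliZ ⊗ₖ pauliX) + u • (pauliZ ⊗ₖ pauliY)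

/-- The operator acting as `S` from the span of `|01⟩, |10⟩` to the span of `|00⟩, |11⟩` and as
`T` in the reverse direction. -/
def oddGate (S T : Matrix (Fin 2) (Fin 2) ℂ) : Matrix (Fin 2 × Fin 2) (Fin 2 × Fin 2) ℂ :=
  Matrix.of fun s t =>
    if s.1 = s.2 ∧ t.1 ≠ t.2 then S s.1 t.1
    else if s.1 ≠ s.2 ∧ t.1 = t.2 then T s.1 t.1
    else 0

lemma gate_mul_oddGate (A B S T : Matrix (Fin 2) (Fin 2) ℂ) :
    gate A B * oddGate S T = oddGate (A * S) (B * T) := by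
  ext ⟨s1, s2⟩ ⟨t1, t2⟩
  fin_cases s1 <;> fin_cases s2 <;> fin_cases t1 <;> fin_cases t2 <;>
    simp [gate, oddGate, Matrix.mul_apply, Fintype.sum_prod_type]

lemma oddGate_mul_gate (A B S T : Matrix (Fin 2) (Fin 2) ℂ) :
    oddGate S T * gate A B = oddGate (S * B) (T * A) := by
  ext ⟨s1, s2⟩ ⟨t1, t2⟩
  fin_cases s1 <;> fin_cases s2 <;> fin_cases t1 <;> fin_cases t2 <;>
    simp [gate, oddGate, Matrix.mul_apply, Fintype.sum_prod_type]

/-- Among the parity-changing operators, combinations of Majorana operators are singled out by the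
relation `T = -adj S` between the two blocks; `oddGate_neg_adjugate` is the converse. -/
lemma majoranaPair_eq_oddGate (p q r u : ℂ) :
    majoranaPair p q r u =
      oddGate !![r - u * Complex.I, p - q * Complex.I; p + q * Complex.I, -(r + u * Complex.I)]
        (-(!![r - u * Complex.I, p - q * Complex.I;
          p + q * Complex.I, -(r + u * Complex.I)]).adjugate) := by
  ext ⟨s1, s2⟩ ⟨t1, t2⟩
  fin_cases s1 <;> fin_cases s2 <;> fin_cases t1 <;> fin_cases t2 <;>
    simp [oddGate, majoranaPair, pauliX, pauliY, pauliZ, Matrix.adjugate_fin_two] <;> ring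

lemma oddGate_neg_adjugate (S : Matrix (Fin 2) (Fin 2) ℂ) :
    oddGate S (-S.adjugate) = majoranaPair ((S 0 1 + S 1 0) / 2)
      ((S 0 1 - S 1 0) * Complex.I / 2) ((S 0 0 - S 1 1) / 2)
      ((S 0 0 + S 1 1) * Complex.I / 2) := by
  have h (x : ℂ) : x * Complex.I / 2 * Complex.I = -x / 2 := by
    linear_combination x / 2 * Complex.I_mul_I
  rw [majoranaPair_eq_oddGate, h, h]
  have : !![(S 0 0 - S 1 1) / 2 - -(S 0 0 + S 1 1) / 2, (S 0 1 + S 1 0) / 2 - -(S 0 1 - S 1 0) / 2;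
      (S 0 1 + S 1 0) / 2 + -(S 0 1 - S 1 0) / 2,
      -((S 0 0 - S 1 1) / 2 + -(S 0 0 + S 1 1) / 2)] = S := by
    ext i j
    fin_cases i <;> fin_cases j <;> simp <;> ring
  rw [this]

/-- Conjugation sends the blocks `S, T` to `A† S B, B† T A`. As the adjugate reverses products and
`A† = adj A`, `B† = adj B`, the relation `T = -adj S` is preserved. -/
lemma IsMatchgate.exists_majoranaPair_mul {G : Matrix (Fin 2 × Fin 2) (Fin 2 × Fin 2) ℂ}
    (hG : IsMatchgate G) (p q r u : ℂ) :
    ∃ p' q' r' u', majoranaPair p q r u * G = G * majoranaPair p' q' r' u' := by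
  have h1 := mul_eq_one_comm.1 hG.conjTranspose_mul_self
  obtain ⟨A, hA, B, hB, rfl⟩ := hG
  have h : ∃ S, (gate A B).conjTranspose * (majoranaPair p q r u * gate A B) =
      oddGate S (-S.adjugate) := by
    rw [gate_conjTranspose, conjTranspose_eq_adjugate hA, conjTranspose_eq_adjugate hB,
      majoranaPair_eq_oddGate]
    generalize !![r - u * Complex.I, p - q * Complex.I;
      p + q * Complex.I, -(r + u * Complex.I)] = S
    refine ⟨A.adjugate * (S * B), ?_⟩
    rw [oddGate_mul_gate, gate_mul_oddGate]
    simp [Matrix.adjugate_mul_distrib, Matrix.adjugate_adjugate', mul_assoc]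
  obtain ⟨S, hS⟩ := h
  rw [oddGate_neg_adjugate] at hS
  exact ⟨_, _, _, _, by rw [← hS, ← mul_assoc, h1, one_mul]⟩

/-- The complex span of the Majorana operators. -/
def majoranaSpan (m : ℕ) : Submodule ℂ (Matrix (BitString m) (BitString m) ℂ) :=
  Submodule.span ℂ {c | ∃ j < m, c = jordanWigner m pauliX j ∨ c = jordanWigner m pauliY j}

lemma jordanWigner_pauliX_mem {m j : ℕ} (hj : j < m) :
    jordanWigner m pauliX j ∈ majoranaSpan m :=
  Submodule.subset_span ⟨j, hj, Or.inl rfl⟩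

lemma jordanWigner_pauliY_mem {m j : ℕ} (hj : j < m) :
    jordanWigner m pauliY j ∈ majoranaSpan m :=
  Submodule.subset_span ⟨j, hj, Or.inr rfl⟩

lemma zString_mul_onNeighbours_majoranaPair {m k : ℕ} (hk : k + 1 < m) (p q r u : ℂ) :
    zString m k * onNeighbours m k hk (majoranaPair p q r u) =
      p • jordanWigner m pauliX k + q • jordanWigner m pauliY k +
        r • jordanWigner m pauliX (k + 1) + u • jordanWigner m pauliY (k + 1) := by
  simp only [jordanWigner_first hk, jordanWigner_second hk, majoranaPair, onNeighbours_add,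
    onNeighbours_smul, mul_add, mul_smul_comm]

/-- Majorana operators of the other qubits commute with the gate; the four of the gate's own qubits
are mixed among themselves. -/
lemma IsMatchgate.exists_majorana_mul {m k : ℕ} (hk : k + 1 < m)
    {G : Matrix (Fin 2 × Fin 2) (Fin 2 × Fin 2) ℂ} (hG : IsMatchgate G)
    {c : Matrix (BitString m) (BitString m) ℂ} (hc : c ∈ majoranaSpan m) :
    ∃ c' ∈ majoranaSpan m, c * onNeighbours m k hk G = onNeighbours m k hk G * c' := by
  have pair (p q r u : ℂ) : ∃ c' ∈ majoranaSpan m,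
      (p • jordanWigner m pauliX k + q • jordanWigner m pauliY k +
        r • jordanWigner m pauliX (k + 1) + u • jordanWigner m pauliY (k + 1)) *
          onNeighbours m k hk G = onNeighbours m k hk G * c' := by
    obtain ⟨p', q', r', u', h⟩ := hG.exists_majoranaPair_mul p q r u
    refine ⟨p' • jordanWigner m pauliX k + q' • jordanWigner m pauliY k +
        r' • jordanWigner m pauliX (k + 1) + u' • jordanWigner m pauliY (k + 1), ?_, ?_⟩
    · have hk' : k < m := Nat.lt_of_succ_lt hk
      exact add_mem (add_mem (add_mem (Submodule.smul_mem _ _ (jordanWigner_pauliX_mem hk'))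
        (Submodule.smul_mem _ _ (jordanWigner_pauliY_mem hk')))
        (Submodule.smul_mem _ _ (jordanWigner_pauliX_mem hk)))
        (Submodule.smul_mem _ _ (jordanWigner_pauliY_mem hk))
    · rw [← zString_mul_onNeighbours_majoranaPair hk, ← zString_mul_onNeighbours_majoranaPair hk,
        mul_assoc, ← onNeighbours_mul, h, onNeighbours_mul, ← mul_assoc, ← mul_assoc,
        (zString_commute hk G).eq]
  induction hc using Submodule.span_induction with
  | mem c hc =>
    obtain ⟨j, hj, hc⟩ := hc
    have hZ : Commute (pauliZ ⊗ₖ pauliZ) G := by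
      obtain ⟨A, -, B, -, rfl⟩ := hG
      exact gate_commute A B
    by_cases h0 : j = k
    · subst h0
      rcases hc with rfl | rfl
      · simpa using pair 1 0 0 0
      · simpa using pair 0 1 0 0
    by_cases h1 : j = k + 1
    · subst h1
      rcases hc with rfl | rfl
      · simpa using pair 0 0 1 0
      · simpa using pair 0 0 0 1
    rcases hc with rfl | rfl
    · exact ⟨_, jordanWigner_pauliX_mem hj, jordanWigner_commute hk _ h0 h1 hZ⟩
    · exact ⟨_, jordanWigner_pauliY_mem hj, jordanWigner_commute hk _ h0 h1 hZ⟩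
  | zero => exact ⟨0, zero_mem _, by simp⟩
  | add c d _ _ hc hd =>
    obtain ⟨c', hc', h⟩ := hc
    obtain ⟨d', hd', h'⟩ := hd
    exact ⟨c' + d', add_mem hc' hd', by rw [add_mul, mul_add, h, h']⟩
  | smul a c _ hc =>
    obtain ⟨c', hc', h⟩ := hc
    exact ⟨a • c', Submodule.smul_mem _ _ hc', by rw [smul_mul_assoc, mul_smul_comm, h]⟩

lemma IsMatchgateCircuit.exists_majorana_mul {m : ℕ} {U : Matrix (BitString m) (BitString m) ℂ}
    (hU : IsMatchgateCircuit m U) {c : Matrix (BitString m) (BitString m) ℂ}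
    (hc : c ∈ majoranaSpan m) : ∃ c' ∈ majoranaSpan m, c * U = U * c' := by
  induction hU using Submonoid.closure_induction generalizing c with
  | mem V hV =>
    obtain ⟨k, hk, G, hG, rfl⟩ := hV
    exact hG.exists_majorana_mul hk hc
  | one => exact ⟨c, hc, by simp⟩
  | mul U V _ _ hU hV =>
    obtain ⟨c', hc', h⟩ := hU hc
    obtain ⟨d, hd, h'⟩ := hV hc'
    exact ⟨d, hd, by rw [← mul_assoc, h, mul_assoc, h', mul_assoc]⟩

lemma IsMatchgateCircuit.conjTranspose_mul_self {m : ℕ}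
    {U : Matrix (BitString m) (BitString m) ℂ} (hU : IsMatchgateCircuit m U) :
    U.conjTranspose * U = 1 := by
  induction hU using Submonoid.closure_induction with
  | mem V hV =>
    obtain ⟨k, hk, G, hG, rfl⟩ := hV
    rw [← onNeighbours_conjTranspose, ← onNeighbours_mul, hG.conjTranspose_mul_self,
      onNeighbours_one]
  | one => simp
  | mul U V _ _ hU hV =>
    rw [Matrix.conjTranspose_mul, mul_assoc, ← mul_assoc U.conjTranspose, hU, one_mul, hV]

/-! ### Realising rotations -/

/-- The real rotation matrix of angle `x`. -/
noncomputable def rotation (x : ℝ) : Matrix (Fin 2) (Fin 2) ℂ :=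
  !![(Real.cos x : ℂ), -(Real.sin x : ℂ); (Real.sin x : ℂ), (Real.cos x : ℂ)]

lemma rotation_mem (x : ℝ) : rotation x ∈ Matrix.specialUnitaryGroup (Fin 2) ℂ := by
  have h : (Real.cos x : ℂ) ^ 2 + (Real.sin x : ℂ) ^ 2 = 1 := by
    exact_mod_cast Real.cos_sq_add_sin_sq x
  rw [Matrix.mem_specialUnitaryGroup_iff, Matrix.mem_unitaryGroup_iff, rotation]
  refine ⟨?_, ?_⟩
  · rw [Matrix.star_eq_conjTranspose]
    ext i j
    fin_cases i <;> fin_cases j <;>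
      simp [Matrix.mul_apply, -Complex.ofReal_cos, -Complex.ofReal_sin] <;>
      grind
  · rw [Matrix.det_fin_two_of]
    linear_combination h

/-- Real blocks do not mix `X`- and `Y`-Majoranas: the former turn by the sum of the two angles, the
latter, in `pauliY_mul_gate_rotation`, by the difference. Both turns can hence be prescribed
independently. -/
lemma pauliX_mul_gate_rotation (x y : ℝ) :
    (pauliX ⊗ₖ (1 : Matrix (Fin 2) (Fin 2) ℂ)) * gate (rotation x) (rotation y) =
      gate (rotation x) (rotation y) *
        majoranaPair (Real.cos (x + y)) 0 (Real.sin (x + y)) 0 := by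
  have hx : (Real.cos x : ℂ) ^ 2 + (Real.sin x : ℂ) ^ 2 = 1 := by
    exact_mod_cast Real.cos_sq_add_sin_sq x
  have hy : (Real.cos y : ℂ) ^ 2 + (Real.sin y : ℂ) ^ 2 = 1 := by
    exact_mod_cast Real.cos_sq_add_sin_sq y
  rw [Real.cos_add, Real.sin_add]
  simp only [rotation]
  push_cast [-Complex.ofReal_cos, -Complex.ofReal_sin]
  generalize (Real.cos x : ℂ) = a at *
  generalize (Real.sin x : ℂ) = b at *
  generalize (Real.cos y : ℂ) = c at *
  generalize (Real.sin y : ℂ) = d at *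
  ext ⟨s1, s2⟩ ⟨t1, t2⟩
  fin_cases s1 <;> fin_cases s2 <;> fin_cases t1 <;> fin_cases t2 <;>
    simp [gate, majoranaPair, pauliX, pauliZ, Matrix.mul_apply, Fintype.sum_prod_type]
  all_goals grind

lemma pauliY_mul_gate_rotation (x y : ℝ) :
    (pauliY ⊗ₖ (1 : Matrix (Fin 2) (Fin 2) ℂ)) * gate (rotation x) (rotation y) =
      gate (rotation x) (rotation y) *
        majoranaPair 0 (Real.cos (x - y)) 0 (- Real.sin (x - y)) := by
  have hx : (Real.cos x : ℂ) ^ 2 + (Real.sin x : ℂ) ^ 2 = 1 := by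
    exact_mod_cast Real.cos_sq_add_sin_sq x
  have hy : (Real.cos y : ℂ) ^ 2 + (Real.sin y : ℂ) ^ 2 = 1 := by
    exact_mod_cast Real.cos_sq_add_sin_sq y
  rw [Real.cos_sub, Real.sin_sub]
  simp only [rotation]
  push_cast [-Complex.ofReal_cos, -Complex.ofReal_sin]
  generalize (Real.cos x : ℂ) = a at *
  generalize (Real.sin x : ℂ) = b at *
  generalize (Real.cos y : ℂ) = c at *
  generalize (Real.sin y : ℂ) = d at *
  ext ⟨s1, s2⟩ ⟨t1, t2⟩
  fin_cases s1 <;> fin_cases s2 <;> fin_cases t1 <;> fin_cases t2 <;>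
    simp [gate, majoranaPair, pauliY, pauliZ, Matrix.mul_apply, Fintype.sum_prod_type]
  all_goals grind

lemma exists_eq_mul_cos_sin {p q t : ℝ} (ht : 0 ≤ t) (h : p ^ 2 + q ^ 2 = t ^ 2) :
    ∃ x : ℝ, p = t * Real.cos x ∧ q = t * Real.sin x := by
  have h1 : ‖(⟨p, q⟩ : ℂ)‖ = t := by
    rw [Complex.norm_eq_sqrt_sq_add_sq, h, Real.sqrt_sq ht]
  refine ⟨Complex.arg ⟨p, q⟩, ?_, ?_⟩
  · rw [← h1, Complex.norm_mul_cos_arg]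
  · rw [← h1, Complex.norm_mul_sin_arg]

/-- A matchgate splitting the Majorana operators of qubit `k` with prescribed amplitudes. -/
lemma exists_circuit_split {m k : ℕ} (hk : k + 1 < m) {p q p' q' t : ℝ} (ht : 0 ≤ t)
    (h : p ^ 2 + q ^ 2 = t ^ 2) (h' : p' ^ 2 + q' ^ 2 = t ^ 2) :
    ∃ V, IsMatchgateCircuit m V ∧
      (t : ℂ) • jordanWigner m pauliX k * V =
        V * ((p : ℂ) • jordanWigner m pauliX k + (q : ℂ) • jordanWigner m pauliX (k + 1)) ∧
      (t : ℂ) • jordanWigner m pauliY k * V =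
        V * ((p' : ℂ) • jordanWigner m pauliY k + (q' : ℂ) • jordanWigner m pauliY (k + 1)) ∧
      ∀ j < k, ∀ σ, Commute (jordanWigner m σ j) V := by
  obtain ⟨x, rfl, rfl⟩ := exists_eq_mul_cos_sin ht h
  obtain ⟨y, rfl, hy⟩ := exists_eq_mul_cos_sin ht (show p' ^ 2 + (-q') ^ 2 = t ^ 2 by rw [neg_sq, h'])
  obtain rfl : q' = t * -Real.sin y := by linarith
  -- The block angles are chosen to have sum `x` and difference `y`. The `Y`-rotation carries
  -- `-sin`, which is why `y` was extracted from `-q'`.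
  refine ⟨onNeighbours m k hk (gate (rotation ((x + y) / 2)) (rotation ((x - y) / 2))),
    Submonoid.subset_closure ⟨k, hk, _, ⟨_, rotation_mem _, _, rotation_mem _, rfl⟩, rfl⟩,
    ?_, ?_, fun j hj σ => jordanWigner_commute hk σ (by omega) (by omega) (gate_commute _ _)⟩
  · rw [smul_mul_assoc, jordanWigner_first hk, mul_assoc, ← onNeighbours_mul,
      pauliX_mul_gate_rotation, onNeighbours_mul, ← mul_assoc, (zString_commute hk _).eq,
      mul_assoc, zString_mul_onNeighbours_majoranaPair, ← mul_smul_comm, ← jordanWigner_first]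
    congr 1
    rw [show (x + y) / 2 + (x - y) / 2 = x by ring]
    push_cast
    module
  · rw [smul_mul_assoc, jordanWigner_first hk, mul_assoc, ← onNeighbours_mul,
      pauliY_mul_gate_rotation, onNeighbours_mul, ← mul_assoc, (zString_commute hk _).eq,
      mul_assoc, zString_mul_onNeighbours_majoranaPair, ← mul_smul_comm, ← jordanWigner_first]
    congr 1
    rw [show (x + y) / 2 - (x - y) / 2 = y by ring]
    push_cast
    module

/-- Circuits spreading the two Majorana operators of the first qubit over the line. -/
lemma exists_circuit_spread {m : ℕ} {a b : ℕ → ℝ} (hab : ∀ j, a j ^ 2 = b j ^ 2)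
    (ha : ∀ r, ∑ j ∈ Finset.range r, a j ^ 2 ≤ 1) (r : ℕ) (hr : r < m) :
    ∃ U, IsMatchgateCircuit m U ∧
      jordanWigner m pauliX 0 * U = U * (∑ j ∈ Finset.range r, (a j : ℂ) • jordanWigner m pauliX j +
        (√(1 - ∑ j ∈ Finset.range r, a j ^ 2) : ℂ) • jordanWigner m pauliX r) ∧
      jordanWigner m pauliY 0 * U = U * (∑ j ∈ Finset.range r, (b j : ℂ) • jordanWigner m pauliY j +
        (√(1 - ∑ j ∈ Finset.range r, a j ^ 2) : ℂ) • jordanWigner m pauliY r) := by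
  induction r with
  | zero => exact ⟨1, one_mem _, by simp, by simp⟩
  | succ r ih =>
    obtain ⟨U, hU, hX, hY⟩ := ih (Nat.lt_of_succ_lt hr)
    have hsq (p : ℝ) (hp : p ^ 2 = a r ^ 2) : p ^ 2 + √(1 - ∑ j ∈ Finset.range (r + 1), a j ^ 2) ^ 2 =
        √(1 - ∑ j ∈ Finset.range r, a j ^ 2) ^ 2 := by
      rw [Real.sq_sqrt (sub_nonneg.2 (ha _)), Real.sq_sqrt (sub_nonneg.2 (ha _)),
        Finset.sum_range_succ, hp]
      ring
    -- Both Majorana operators have the same amplitude left on qubit `r`, because `a` and `b` have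
    -- equal squares. One gate leaves `a r` and `b r` there and passes the remainder on to qubit `r
    -- + 1`.
    obtain ⟨V, hV, hVX, hVY, hVc⟩ := exists_circuit_split hr (Real.sqrt_nonneg _) (hsq _ rfl)
      (hsq (b r) (hab r).symm)
    have hsum (c : ℕ → ℝ) (σ) : (∑ j ∈ Finset.range r, (c j : ℂ) • jordanWigner m σ j) * V =
        V * ∑ j ∈ Finset.range r, (c j : ℂ) • jordanWigner m σ j := by
      rw [Finset.sum_mul, Finset.mul_sum]
      refine Finset.sum_congr rfl fun j hj => ?_
      rw [smul_mul_assoc, mul_smul_comm, (hVc j (Finset.mem_range.1 hj) σ).eq]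
    refine ⟨U * V, mul_mem hU hV, ?_, ?_⟩
    · rw [← mul_assoc, hX, mul_assoc, add_mul, hsum, hVX, ← mul_add, ← mul_assoc,
        Finset.sum_range_succ (fun j => (a j : ℂ) • jordanWigner m pauliX j), add_assoc]
    · rw [← mul_assoc, hY, mul_assoc, add_mul, hsum, hVY, ← mul_add, ← mul_assoc,
        Finset.sum_range_succ (fun j => (b j : ℂ) • jordanWigner m pauliY j), add_assoc]

/-! ### Measurement statistics -/

/-- If the qubits differ, the earlier one carries `σ Z` or `Z τ`, whose diagonal vanishes. If they
agree, the strings cancel. -/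
lemma jordanWigner_mul_apply_self {m : ℕ} {σ τ : Matrix (Fin 2) (Fin 2) ℂ}
    (hσ : ∀ b, σ b b = 0) (hτ : ∀ b, τ b b = 0) {j l : ℕ} (hj : j < m) (hl : l < m)
    (y : BitString m) :
    (jordanWigner m σ j * jordanWigner m τ l) y y =
      if j = l then (σ * τ) (y ⟨j, hj⟩) (y ⟨j, hj⟩) else 0 := by
  rw [jordanWigner, jordanWigner, tensorMatrix_mul, tensorMatrix, Matrix.of_apply]
  split_ifs with h
  · subst h
    rw [Finset.prod_eq_single ⟨j, hj⟩]
    · simp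
    · intro i _ hi
      rw [Ne, Fin.ext_iff] at hi
      simp only [if_neg hi]
      split_ifs
      · rw [pauliZ_mul_self, Matrix.one_apply_eq]
      · rw [one_mul, Matrix.one_apply_eq]
    · simp
  · rcases lt_or_gt_of_ne h with h | h
    · refine Finset.prod_eq_zero (Finset.mem_univ ⟨j, hj⟩) ?_
      generalize y ⟨j, hj⟩ = b
      simp only [lt_irrefl, if_false, if_true, h]
      have := hσ b
      fin_cases b <;> simp_all [Matrix.mul_apply, pauliZ]
    · refine Finset.prod_eq_zero (Finset.mem_univ ⟨l, hl⟩) ?_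
      generalize y ⟨l, hl⟩ = b
      simp only [lt_irrefl, if_false, if_true, h]
      have := hτ b
      fin_cases b <;> simp_all [Matrix.mul_apply, pauliZ]

lemma pauliX_apply_self (b : Fin 2) : pauliX b b = 0 := by
  fin_cases b <;> simp [pauliX]

lemma pauliY_apply_self (b : Fin 2) : pauliY b b = 0 := by
  fin_cases b <;> simp [pauliY]

lemma bitSign_zero : bitSign 0 = 1 := by simp [bitSign]

lemma bitSign_one : bitSign 1 = -1 := by simp [bitSign]

lemma bitSign_cases (b : Fin 2) : bitSign b = 1 ∨ bitSign b = -1 := by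
  fin_cases b <;> simp [bitSign]

lemma pauliX_mul_pauliY_apply_self (b : Fin 2) :
    (pauliX * pauliY) b b = Complex.I * bitSign b := by
  fin_cases b <;> simp [pauliX, pauliY, bitSign]

lemma pauliY_mul_pauliX_apply_self (b : Fin 2) :
    (pauliY * pauliX) b b = -Complex.I * bitSign b := by
  fin_cases b <;> simp [pauliX, pauliY, bitSign]

lemma pauliX_mul_self : pauliX * pauliX = 1 := by
  ext i j; fin_cases i <;> fin_cases j <;> simp [pauliX]

lemma pauliY_mul_self : pauliY * pauliY = 1 := by
  ext i j; fin_cases i <;> fin_cases j <;> simp [pauliY]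

lemma jordanWigner_X_mul_Y_zero {m : ℕ} (hm : 0 < m) :
    jordanWigner m pauliX 0 * jordanWigner m pauliY 0 =
      Matrix.diagonal fun z => Complex.I * bitSign (z ⟨0, hm⟩) := by
  ext z y
  rw [jordanWigner, jordanWigner, tensorMatrix_mul, tensorMatrix, Matrix.of_apply,
    Matrix.diagonal_apply]
  split_ifs with h
  · subst h
    rw [Finset.prod_eq_single ⟨0, hm⟩]
    · simp [pauliX_mul_pauliY_apply_self]
    · intro i _ hi
      rw [Ne, Fin.ext_iff] at hi
      simp only [Nat.not_lt_zero, if_false, if_neg hi, one_mul, Matrix.one_apply_eq]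
    · simp
  · obtain ⟨j, hj⟩ := Function.ne_iff.1 h
    refine Finset.prod_eq_zero (Finset.mem_univ j) ?_
    simp only [Nat.not_lt_zero, if_false]
    split_ifs
    · revert hj
      generalize z j = s, y j = t
      intro hj
      fin_cases s <;> fin_cases t <;> simp_all [pauliX, pauliY]
    · rw [one_mul, Matrix.one_apply_ne hj]

/-- The outcome probabilities in terms of the images of the two Majorana operators of the first
qubit. -/
lemma IsMatchgateCircuit.probFirst_eq {m : ℕ} (hm : 0 < m)
    {U c d : Matrix (BitString m) (BitString m) ℂ} (hU : IsMatchgateCircuit m U)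
    (hc : jordanWigner m pauliX 0 * U = U * c) (hd : jordanWigner m pauliY 0 * U = U * d)
    (y : BitString m) (b : Fin 2) :
    probFirst hm (U.mulVec (ket y)) b = (1 + bitSign b * ((c * d) y y).im) / 2 := by
  have hψ : U.mulVec (ket y) = fun z => U z y := by
    funext z
    simp [ket]
  have hnorm (z) : star (U z y) * U z y = ((‖U z y‖ ^ 2 : ℝ) : ℂ) := by
    rw [Complex.star_def, Complex.conj_mul']
    push_cast; rfl
  have h1 : ∑ z, ‖U z y‖ ^ 2 = 1 := by
    have := congrFun (congrFun hU.conjTranspose_mul_self y) y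
    rw [Matrix.mul_apply, Matrix.one_apply_eq] at this
    simp only [Matrix.conjTranspose_apply, hnorm] at this
    exact_mod_cast this
  have h2 : ∑ z, bitSign (z ⟨0, hm⟩) * ‖U z y‖ ^ 2 = ((c * d) y y).im := by
    -- This is the Heisenberg picture: the observable `XY = iZ` of the first qubit is conjugated
    -- into `c * d`.
    have h3 : U.conjTranspose * (jordanWigner m pauliX 0 * jordanWigner m pauliY 0 * U) = c * d := by
      rw [mul_assoc, hd, ← mul_assoc (jordanWigner m pauliX 0), hc, mul_assoc, ← mul_assoc,
        hU.conjTranspose_mul_self, one_mul]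
    have h4 : (c * d) y y = Complex.I * ((∑ z, bitSign (z ⟨0, hm⟩) * ‖U z y‖ ^ 2 : ℝ) : ℂ) := by
      rw [← h3, jordanWigner_X_mul_Y_zero hm, Matrix.mul_apply]
      simp only [Matrix.conjTranspose_apply, Matrix.diagonal_mul]
      rw [Complex.ofReal_sum, Finset.mul_sum]
      refine Finset.sum_congr rfl fun z _ => ?_
      rw [Complex.ofReal_mul, ← hnorm]
      ring
    rw [h4, Complex.I_mul_im, Complex.ofReal_re]
  rw [probFirst, hψ, ← h2, ← h1, Finset.mul_sum, ← Finset.sum_add_distrib, Finset.sum_div]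
  refine Finset.sum_congr rfl fun z _ => ?_
  generalize z ⟨0, hm⟩ = s
  fin_cases s <;> fin_cases b <;> simp [bitSign]

/-! ### Diagonals of quadratic operators -/

/-- The span of the functions `1` and `y ↦ (-1)^(y k)`. -/
def affineSpan (m : ℕ) : Submodule ℂ (BitString m → ℂ) :=
  Submodule.span ℂ (insert (fun _ => 1) (Set.range fun (k : Fin m) y => (bitSign (y k) : ℂ)))

lemma exists_of_mem_affineSpan {m : ℕ} {g : BitString m → ℂ} (hg : g ∈ affineSpan m) :
    ∃ (w : Fin m → ℂ) (θ : ℂ), ∀ y, g y = ∑ k, w k * bitSign (y k) + θ := by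
  obtain ⟨θ, h, hh, rfl⟩ := Submodule.mem_span_insert.1 hg
  obtain ⟨w, rfl⟩ := (Submodule.mem_span_range_iff_exists_fun ℂ).1 hh
  refine ⟨w, θ, fun y => ?_⟩
  simp [Finset.sum_apply, add_comm]

/-- By bilinearity only pairs of generators matter. On a common qubit, `XX = YY = 1` gives a
constant and `XY = -YX = iZ` a multiple of a sign. -/
lemma diag_mul_mem_affineSpan {m : ℕ} {c d : Matrix (BitString m) (BitString m) ℂ}
    (hc : c ∈ majoranaSpan m) (hd : d ∈ majoranaSpan m) :
    (fun y => (c * d) y y) ∈ affineSpan m := by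
  have hone : (fun _ => 1) ∈ affineSpan m := Submodule.subset_span (Set.mem_insert _ _)
  have hsign (k : Fin m) : (fun y : BitString m => (bitSign (y k) : ℂ)) ∈ affineSpan m :=
    Submodule.subset_span (Set.mem_insert_of_mem _ ⟨k, rfl⟩)
  induction hc using Submodule.span_induction with
  | zero =>
    simp only [zero_mul]
    exact zero_mem (affineSpan m)
  | add c c' _ _ h h' =>
    simp only [add_mul]
    exact add_mem h h'
  | smul a c _ h =>
    simp only [smul_mul_assoc]
    exact Submodule.smul_mem _ a h
  | mem c hc =>
    induction hd using Submodule.span_induction with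
    | zero =>
      simp only [mul_zero]
      exact zero_mem (affineSpan m)
    | add d d' _ _ h h' =>
      simp only [mul_add]
      exact add_mem h h'
    | smul a d _ h =>
      simp only [mul_smul_comm]
      exact Submodule.smul_mem _ a h
    | mem d hd =>
      obtain ⟨j, hj, hc⟩ := hc
      obtain ⟨l, hl, hd⟩ := hd
      rcases hc with rfl | rfl <;> rcases hd with rfl | rfl
      all_goals
        simp only [jordanWigner_mul_apply_self pauliX_apply_self pauliX_apply_self hj hl,
          jordanWigner_mul_apply_self pauliX_apply_self pauliY_apply_self hj hl,
          jordanWigner_mul_apply_self pauliY_apply_self pauliX_apply_self hj hl,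
          jordanWigner_mul_apply_self pauliY_apply_self pauliY_apply_self hj hl,
          pauliX_mul_self, pauliY_mul_self, pauliX_mul_pauliY_apply_self,
          pauliY_mul_pauliX_apply_self, Matrix.one_apply_eq]
        by_cases h : j = l
        · simp only [if_pos h]
          first | exact hone | exact Submodule.smul_mem _ _ (hsign ⟨j, hj⟩)
        · simp only [if_neg h]
          exact zero_mem (affineSpan m)

/-! ### Computability and affine functions of signs -/

/-- Matchgate circuits compute affine functions of the signs of the input bits. -/
lemma MatchgateComputable.exists_affine {n : ℕ} {f : BitString n → Fin 2} {p : ℝ}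
    (h : MatchgateComputable f p) :
    ∃ (w : Fin n → ℝ) (θ : ℝ), ∀ x : BitString n, |∑ k, w k * bitSign (x k) + θ| ≤ 1 ∧
      2 * p - 1 ≤ bitSign (f x) * (∑ k, w k * bitSign (x k) + θ) := by
  obtain ⟨m, hm, U, hnm, hU, hcomp⟩ := h
  obtain ⟨c, hc, hcU⟩ := hU.exists_majorana_mul (jordanWigner_pauliX_mem hm)
  obtain ⟨d, hd, hdU⟩ := hU.exists_majorana_mul (jordanWigner_pauliY_mem hm)
  obtain ⟨w, θ, hw⟩ := exists_of_mem_affineSpan (diag_mul_mem_affineSpan hc hd)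
  obtain ⟨l, rfl⟩ := Nat.exists_eq_add_of_le hnm
  -- Padding bits are 0 and have sign 1, so their weights join the threshold.
  refine ⟨fun k => (w (Fin.castAdd l k)).im, ∑ k : Fin l, (w (Fin.natAdd n k)).im + θ.im,
    fun x => ?_⟩
  have key : ((c * d) (pad (n + l) x) (pad (n + l) x)).im =
      ∑ k, (w (Fin.castAdd l k)).im * bitSign (x k) +
        (∑ k : Fin l, (w (Fin.natAdd n k)).im + θ.im) := by
    rw [hw, Fin.sum_univ_add]
    simp [pad, bitSign_zero, add_assoc]
  rw [← key]
  have hprob := hU.probFirst_eq hm hcU hdU (pad (n + l) x)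
  have hnonneg (b) : 0 ≤ probFirst hm (U.mulVec (ket (pad (n + l) x))) b :=
    Finset.sum_nonneg fun z _ => by split_ifs <;> positivity
  constructor
  · have h0 := hnonneg 0
    have h1 := hnonneg 1
    rw [hprob] at h0 h1
    rw [bitSign_zero] at h0
    rw [bitSign_one] at h1
    exact abs_le.2 ⟨by linarith, by linarith⟩
  · have := hcomp x
    rw [hprob] at this
    linarith

/-- Normalised affine functions of the signs of the input bits are realised by matchgate
circuits. -/
lemma MatchgateComputable.of_affine {n : ℕ} {f : BitString n → Fin 2} {w : Fin n → ℝ} {θ δ : ℝ}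
    (hw : ∑ k, |w k| + |θ| = 1)
    (h : ∀ x : BitString n, δ ≤ bitSign (f x) * (∑ k, w k * bitSign (x k) + θ)) :
    MatchgateComputable f ((1 + δ) / 2) := by
  -- The threshold is the coefficient of an extra qubit `n`, whose input bit is 0.
  set v : ℕ → ℝ := fun j => if hj : j < n then w ⟨j, hj⟩ else if j = n then θ else 0 with hv
  have hvw (k : Fin n) : v k = w k := by simp [hv]
  have hvn : v n = θ := by simp [hv]
  have hv0 {j : ℕ} (hj : n < j) : v j = 0 := by
    simp [hv, hj.not_gt, hj.ne']
  have hsum : ∑ j ∈ Finset.range (n + 1), |v j| = 1 := by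
    rw [Finset.sum_range_succ, Finset.sum_range, hvn, ← hw]
    simp [hvw]
  have hsum' (r : ℕ) : ∑ j ∈ Finset.range r, |v j| ≤ 1 := by
    rw [← hsum]
    rcases le_total r (n + 1) with hr | hr
    · exact Finset.sum_le_sum_of_subset_of_nonneg (Finset.range_subset_range.2 hr)
        fun _ _ _ => abs_nonneg _
    · refine (Finset.sum_subset (Finset.range_subset_range.2 hr) fun j _ hj => ?_).ge
      rw [hv0 (by simpa using hj), abs_zero]
  have ha (j) : √|v j| ^ 2 = |v j| := Real.sq_sqrt (abs_nonneg _)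
  have hab (j) : √|v j| * (SignType.sign (v j) * √|v j|) = v j := by
    rw [mul_left_comm, ← sq, ha, sign_mul_abs]
  have hb (j) : √|v j| ^ 2 = (SignType.sign (v j) * √|v j|) ^ 2 := by
    rcases lt_trichotomy (v j) 0 with h | h | h <;> simp [h]
  -- Qubit `n + 1` takes the remaining amplitude, which is zero because the 1-norm is one.
  obtain ⟨U, hU, hX, hY⟩ := exists_circuit_spread (m := n + 2) hb (by simpa only [ha] using hsum')
    (n + 1) (by omega)
  simp only [ha, hsum, sub_self, Real.sqrt_zero, Complex.ofReal_zero, zero_smul, add_zero] at hX hY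
  refine ⟨n + 2, by omega, U, by omega, hU, fun x => ?_⟩
  rw [hU.probFirst_eq _ hX hY]
  have key : (((∑ j ∈ Finset.range (n + 1), (√|v j| : ℂ) • jordanWigner (n + 2) pauliX j) *
      ∑ j ∈ Finset.range (n + 1), ((SignType.sign (v j) * √|v j| : ℝ) : ℂ) •
        jordanWigner (n + 2) pauliY j) (pad (n + 2) x) (pad (n + 2) x)).im =
      ∑ k, w k * bitSign (x k) + θ := by
    have h1 : ((∑ j ∈ Finset.range (n + 1), (√|v j| : ℂ) • jordanWigner (n + 2) pauliX j) *
      ∑ j ∈ Finset.range (n + 1), ((SignType.sign (v j) * √|v j| : ℝ) : ℂ) •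
        jordanWigner (n + 2) pauliY j) (pad (n + 2) x) (pad (n + 2) x) =
        Complex.I * ((∑ j : Fin (n + 1), v j * bitSign (pad (n + 2) x ⟨j, by omega⟩) : ℝ) : ℂ) := by
      rw [Finset.sum_range, Finset.sum_range, Finset.sum_mul_sum, Matrix.sum_apply,
        Complex.ofReal_sum, Finset.mul_sum]
      refine Finset.sum_congr rfl fun i _ => ?_
      rw [Matrix.sum_apply, Finset.sum_eq_single i]
      · rw [smul_mul_smul_comm, Matrix.smul_apply, jordanWigner_mul_apply_self pauliX_apply_self
          pauliY_apply_self (by omega) (by omega), if_pos rfl, pauliX_mul_pauliY_apply_self,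
          ← Complex.ofReal_mul, hab, smul_eq_mul, Complex.ofReal_mul]
        ring
      · intro j _ hj
        rw [smul_mul_smul_comm, Matrix.smul_apply, jordanWigner_mul_apply_self pauliX_apply_self
          pauliY_apply_self (by omega) (by omega), if_neg (fun h => hj (Fin.ext h.symm)), smul_zero]
      · simp
    rw [h1, Fin.sum_univ_castSucc]
    simp [hvw, hvn, pad, bitSign_zero]
  rw [key]
  linarith [h x]

/-! ### Integer representations -/

lemma abs_bitSign (b : Fin 2) : |bitSign b| = 1 := by
  rcases bitSign_cases b with h | h <;> simp [h]

lemma isRepresentation_of_pos {n : ℕ} {w : Fin n → ℝ} {θ : ℝ} {f : BitString n → Fin 2}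
    (h : ∀ x, 0 < bitSign (f x) * (∑ k, w k * bitSign (x k) + θ)) : IsRepresentation w θ f := by
  intro x
  have hx := h x
  rcases bitSign_cases (f x) with hf | hf <;> rw [hf] at hx ⊢
  · exact Real.sign_of_pos (by linarith)
  · exact Real.sign_of_neg (by linarith)

/-- The value is an integer, and it is nonzero because its sign is `±1`. -/
lemma IsRepresentation.one_le {n : ℕ} {v : Fin n → ℤ} {φ : ℤ} {f : BitString n → Fin 2}
    (h : IsRepresentation (fun k => (v k : ℝ)) (φ : ℝ) f) (x : BitString n) :
    1 ≤ bitSign (f x) * (∑ k, (v k : ℝ) * bitSign (x k) + φ) := by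
  have hx := h x
  have hint : ∃ z : ℤ, ∑ k, (v k : ℝ) * bitSign (x k) + φ = z := by
    refine ⟨∑ k, v k * (-1) ^ (x k : ℕ) + φ, ?_⟩
    push_cast [bitSign]
    rfl
  obtain ⟨z, hz⟩ := hint
  simp only [hz] at hx ⊢
  rw [← hx]
  rcases lt_trichotomy z 0 with h0 | h0 | h0
  · rw [Real.sign_of_neg (by exact_mod_cast h0)]
    have : (z : ℝ) ≤ -1 := by exact_mod_cast Int.le_sub_one_of_lt h0
    linarith
  · rw [h0, Int.cast_zero, Real.sign_zero] at hx
    rcases bitSign_cases (f x) with hf | hf <;> rw [hf] at hx <;> norm_num at hx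
  · rw [Real.sign_of_pos (by exact_mod_cast h0)]
    have : (1 : ℝ) ≤ z := by exact_mod_cast h0
    linarith

/-- An affine function of signs with values in `[-1, 1]` has 1-norm at most one. -/
lemma sum_abs_add_abs_le_one {n : ℕ} {w : Fin n → ℝ} {θ : ℝ}
    (h : ∀ x : BitString n, |∑ k, w k * bitSign (x k) + θ| ≤ 1) : ∑ k, |w k| + |θ| ≤ 1 := by
  -- The input matching the signs of `w` gives `∑ |w k| + θ ≤ 1`; the opposite input gives `∑ |w k|
  -- - θ ≤ 1`.
  have h1 := (abs_le.1 (h fun k => if 0 ≤ w k then 0 else 1)).2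
  have h2 := (abs_le.1 (h fun k => if 0 ≤ w k then 1 else 0)).1
  have e1 : ∑ k, w k * bitSign (if 0 ≤ w k then 0 else 1) = ∑ k, |w k| := by
    refine Finset.sum_congr rfl fun k _ => ?_
    split_ifs with hk
    · rw [bitSign_zero, mul_one, abs_of_nonneg hk]
    · rw [bitSign_one, mul_neg_one, abs_of_neg (not_le.1 hk)]
  have e2 : ∑ k, w k * bitSign (if 0 ≤ w k then 1 else 0) = -∑ k, |w k| := by
    rw [← Finset.sum_neg_distrib]
    refine Finset.sum_congr rfl fun k _ => ?_
    split_ifs with hk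
    · rw [bitSign_one, mul_neg_one, abs_of_nonneg hk]
    · rw [bitSign_zero, mul_one, abs_of_neg (not_le.1 hk), neg_neg]
  rw [e1] at h1
  rw [e2] at h2
  rcases abs_cases θ with ⟨ht, -⟩ | ⟨ht, -⟩ <;> linarith

/-- Rounding a multiple of an affine function with a large margin. -/
lemma exists_integer_representation {n : ℕ} {f : BitString n → Fin 2} {w : Fin n → ℝ} {θ δ : ℝ}
    (hw : ∑ k, |w k| + |θ| ≤ 1)
    (h : ∀ x : BitString n, δ ≤ bitSign (f x) * (∑ k, w k * bitSign (x k) + θ)) (N : ℕ)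
    (hN : (n + 1 : ℝ) ≤ N * δ) :
    ∃ (v : Fin n → ℤ) (φ : ℤ), IsRepresentation (fun k => (v k : ℝ)) (φ : ℝ) f ∧
      ∑ k, (v k).natAbs + φ.natAbs ≤ N + (n + 1) := by
  have hround (a : ℝ) : |N * a - round (N * a)| ≤ 1 / 2 := abs_sub_round _
  refine ⟨fun k => round (N * w k), round (N * θ), isRepresentation_of_pos fun x => ?_, ?_⟩
  · set A := ∑ k, w k * bitSign (x k) + θ with hA
    set B := ∑ k, (round (N * w k) : ℝ) * bitSign (x k) + round (N * θ) with hB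
    -- Each of the `n + 1` rounded coefficients costs at most `1/2`, in total less than the scaled
    -- margin `N * δ ≥ n + 1`.
    have hdiff : |N * A - B| ≤ (n + 1) / 2 := by
      have : N * A - B = ∑ k, (N * w k - round (N * w k)) * bitSign (x k) +
          (N * θ - round (N * θ)) := by
        rw [hA, hB, mul_add, Finset.mul_sum]
        simp only [sub_mul, Finset.sum_sub_distrib, mul_assoc]
        ring
      rw [this]
      calc _ ≤ ∑ k : Fin n, |(N * w k - round (N * w k)) * bitSign (x k)| +
            |N * θ - round (N * θ)| :=
            (abs_add_le _ _).trans (add_le_add_left (Finset.abs_sum_le_sum_abs _ _) _)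
        _ ≤ ∑ k : Fin n, (1 / 2 : ℝ) + 1 / 2 := by
            refine add_le_add (Finset.sum_le_sum fun k _ => ?_) (hround _)
            rw [abs_mul, abs_bitSign, mul_one]
            exact hround _
        _ = (n + 1) / 2 := by simp; ring
    have hx : N * δ ≤ bitSign (f x) * (N * A) := by
      have := mul_le_mul_of_nonneg_left (h x) (Nat.cast_nonneg (α := ℝ) N)
      linarith
    have hn : (0 : ℝ) ≤ n := n.cast_nonneg
    obtain ⟨h1, h2⟩ := abs_le.1 hdiff
    rcases bitSign_cases (f x) with hf | hf <;> rw [hf] at hx ⊢ <;> linarith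
  · have hle (a : ℝ) : ((round (N * a)).natAbs : ℝ) ≤ N * |a| + 1 / 2 := by
      rw [Nat.cast_natAbs, Int.cast_abs]
      have h1 := hround a
      have h2 := abs_sub_abs_le_abs_sub (round (N * a) : ℝ) (N * a)
      rw [abs_sub_comm, abs_mul, Nat.abs_cast] at h2
      linarith
    have : ((∑ k, (round (N * w k)).natAbs + (round (N * θ)).natAbs : ℕ) : ℝ) ≤ N + (n + 1) := by
      push_cast
      calc _ ≤ ∑ k : Fin n, (N * |w k| + 1 / 2) + (N * |θ| + 1 / 2) :=
            add_le_add (Finset.sum_le_sum fun k _ => hle _) (hle _)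
        _ = N * (∑ k, |w k| + |θ|) + (n + 1) / 2 := by
            rw [Finset.sum_add_distrib, ← Finset.mul_sum]
            simp
            ring
        _ ≤ N * 1 + (n + 1) := by
            have hn : (0 : ℝ) ≤ n := n.cast_nonneg
            gcongr
            linarith
        _ = _ := by ring
    exact_mod_cast this

lemma integerWeight_le {n : ℕ} {f : BitString n → Fin 2} {v : Fin n → ℤ} {φ : ℤ}
    (h : IsRepresentation (fun k => (v k : ℝ)) (φ : ℝ) f) {W : ℕ}
    (hW : ∑ k, (v k).natAbs + φ.natAbs ≤ W) : integerWeight f ≤ W := by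
  rw [integerWeight]
  refine iInf_le_of_le v (iInf_le_of_le φ (iInf_le_of_le h ?_))
  exact_mod_cast hW

/-- A finite infimum in `ℕ∞` is attained: otherwise every term would be at least `W + 1`. -/
lemma exists_of_integerWeight_le {n : ℕ} {f : BitString n → Fin 2} {W : ℕ}
    (h : integerWeight f ≤ W) :
    ∃ (v : Fin n → ℤ) (φ : ℤ), IsRepresentation (fun k => (v k : ℝ)) (φ : ℝ) f ∧
      ∑ k, (v k).natAbs + φ.natAbs ≤ W := by
  by_contra! hcon
  have : ((W + 1 : ℕ) : ℕ∞) ≤ integerWeight f :=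
    le_iInf fun v => le_iInf fun φ => le_iInf fun hv => by exact_mod_cast hcon v φ hv
  have := this.trans h
  norm_cast at this
  omega

/-! ### Success probability versus integer weight -/

lemma MatchgateComputable.integerWeight_le_of_margin {n : ℕ} {f : BitString n → Fin 2} {p : ℝ}
    (h : MatchgateComputable f p) {N : ℕ} (hN : (n + 1 : ℝ) ≤ N * (2 * p - 1)) :
    integerWeight f ≤ ((N + (n + 1) : ℕ) : ℕ∞) := by
  obtain ⟨w, θ, hw⟩ := h.exists_affine
  obtain ⟨v, φ, hv, hW⟩ := exists_integer_representation
    (sum_abs_add_abs_le_one fun x => (hw x).1) (fun x => (hw x).2) N hN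
  exact integerWeight_le hv hW

lemma MatchgateComputable.isLTG {n : ℕ} {f : BitString n → Fin 2} {p : ℝ}
    (h : MatchgateComputable f p) (hp : 1 / 2 < p) : IsLTG f := by
  obtain ⟨w, θ, hw⟩ := h.exists_affine
  exact ⟨w, θ, isRepresentation_of_pos fun x => by linarith [(hw x).2]⟩

/-- Dividing an integer representation by its 1-norm `S ≤ W` leaves margin at least `1 / S`. The
weaker `1 / (W + 1)` has a positive denominator for every `W`. -/
lemma matchgateComputable_of_integerWeight_le {n : ℕ} {f : BitString n → Fin 2} {W : ℕ}
    (h : integerWeight f ≤ W) : MatchgateComputable f (1 / 2 + 1 / (2 * (W + 1))) := by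
  obtain ⟨v, φ, hv, hW⟩ := exists_of_integerWeight_le h
  set S : ℝ := ∑ k, |(v k : ℝ)| + |(φ : ℝ)| with hS
  have hSW : S ≤ W := by
    have : S = ((∑ k, (v k).natAbs + φ.natAbs : ℕ) : ℝ) := by
      rw [hS]
      push_cast [Nat.cast_natAbs]
      rfl
    rw [this]
    exact_mod_cast hW
  have hS0 : 0 < S := by
    refine lt_of_le_of_ne (by positivity) fun h0 => ?_
    have hφ : (φ : ℝ) = 0 := by
      have : 0 ≤ ∑ k, |(v k : ℝ)| := by positivity
      exact abs_nonpos_iff.1 (by linarith)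
    have hv0 : ∀ k, (v k : ℝ) = 0 := by
      have : ∑ k, |(v k : ℝ)| = 0 := by rw [hφ, abs_zero] at hS; linarith
      intro k
      exact abs_eq_zero.1 ((Finset.sum_eq_zero_iff_of_nonneg fun _ _ => abs_nonneg _).1 this k
        (Finset.mem_univ k))
    have := hv.one_le 0
    simp [hφ, hv0] at this
    linarith
  have hmargin : ∀ x : BitString n,
      1 / ((W : ℝ) + 1) ≤ bitSign (f x) * (∑ k, v k / S * bitSign (x k) + φ / S) := by
    intro x
    have : bitSign (f x) * (∑ k, v k / S * bitSign (x k) + φ / S) =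
        bitSign (f x) * (∑ k, (v k : ℝ) * bitSign (x k) + φ) / S := by
      rw [mul_div_assoc, add_div, Finset.sum_div]
      simp only [div_mul_eq_mul_div]
    rw [this]
    exact div_le_div₀ (zero_le_one.trans (hv.one_le x)) (hv.one_le x) hS0 (by linarith)
  have hnorm : ∑ k, |v k / S| + |φ / S| = 1 := by
    simp only [abs_div, abs_of_pos hS0]
    rw [← Finset.sum_div, ← add_div, ← hS, div_self hS0.ne']
  convert MatchgateComputable.of_affine hnorm hmargin using 1
  field_simp

end Matchgates

open Matchgates in
theorem theorem3 (f : (n : ℕ) → Matchgates.BitString n → Fin 2) :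
    Matchgates.MatchgateComputablePolyBounded f ↔
      Matchgates.IsLTGFamilyPolyIntegerWeight f := by
  constructor
  · rintro ⟨p, hp, ⟨q, N, hq⟩, hf⟩
    refine ⟨fun n hn => (hf n hn).isLTG (hp n hn).1, ?_⟩
    have hfin : ∀ n, ∃ W : ℕ, 1 ≤ n → integerWeight (f n) ≤ W := by
      intro n
      by_cases hn : 1 ≤ n
      · have hpos : 0 < 2 * p n - 1 := by linarith [(hp n hn).1]
        obtain ⟨M, hM⟩ := exists_nat_ge ((n + 1 : ℝ) / (2 * p n - 1))
        exact ⟨_, fun _ => (hf n hn).integerWeight_le_of_margin ((div_le_iff₀ hpos).1 hM)⟩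
      · exact ⟨0, fun h => absurd h hn⟩
    choose W hW using hfin
    -- For `n ≥ N`, scaling by `(n + 1) q(n)` before rounding gives weight at most `(n + 1) q(n) +
    -- (n + 1)`. For `n < N` there is only a finite bound `W n`, absorbed by the constant term.
    refine ⟨(Polynomial.X + 1) * (q + 1) + Polynomial.C (∑ n ∈ Finset.range N, W n),
      fun n hn => ?_⟩
    rcases lt_or_ge n N with h | h
    · refine (hW n hn).trans ?_
      have : W n ≤ ∑ n ∈ Finset.range N, W n :=
        Finset.single_le_sum (fun _ _ => Nat.zero_le _) (Finset.mem_range.2 h)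
      have h' : W n ≤ ((Polynomial.X + 1) * (q + 1) +
          Polynomial.C (∑ n ∈ Finset.range N, W n)).eval n := by
        rw [Polynomial.eval_add, Polynomial.eval_C]
        omega
      exact_mod_cast h'
    · obtain ⟨hq0, hq1⟩ := hq n h
      have hq0' : (0 : ℝ) < (q.eval n : ℕ) := by exact_mod_cast hq0
      have hmargin : (n + 1 : ℝ) ≤ (((n + 1) * q.eval n : ℕ) : ℝ) * (2 * p n - 1) := by
        push_cast
        have h1 : 1 ≤ (q.eval n : ℕ) * (2 * p n - 1) := by
          have h2 : 1 / ((q.eval n : ℕ) : ℝ) ≤ 2 * p n - 1 := by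
            have : 0 < 1 / ((q.eval n : ℕ) : ℝ) := by positivity
            linarith
          rwa [div_le_iff₀' hq0'] at h2
        have h3 : (0 : ℝ) ≤ n + 1 := by positivity
        nlinarith
      refine ((hf n hn).integerWeight_le_of_margin hmargin).trans ?_
      have h' : (n + 1) * q.eval n + (n + 1) ≤ ((Polynomial.X + 1) * (q + 1) +
          Polynomial.C (∑ n ∈ Finset.range N, W n)).eval n := by
        simp only [Polynomial.eval_add, Polynomial.eval_C, Polynomial.eval_mul, Polynomial.eval_X,
          Polynomial.eval_one]
        rw [mul_add, mul_one]
        omega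
      exact_mod_cast h'
  · rintro ⟨-, r, hr⟩
    have hpos (n : ℕ) : (0 : ℝ) ≤ (r.eval n : ℕ) := Nat.cast_nonneg _
    -- The added 1 makes the error polynomial `2 * (r + 1)` positive everywhere and keeps the
    -- probabilities at most one.
    refine ⟨fun n => 1 / 2 + 1 / (2 * ((r.eval n : ℕ) + 1)), fun n _ => ⟨?_, ?_⟩,
      ⟨2 * (r + 1), 0, fun n _ => ⟨?_, ?_⟩⟩,
      fun n hn => matchgateComputable_of_integerWeight_le (hr n hn)⟩
    · have := hpos n
      have : (0 : ℝ) < 1 / (2 * ((r.eval n : ℕ) + 1)) := by positivity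
      linarith
    · have := hpos n
      have : 1 / (2 * (((r.eval n : ℕ) : ℝ) + 1)) ≤ 1 / 2 :=
        one_div_le_one_div_of_le (by norm_num) (by linarith)
      linarith
    · simp
    · simp
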